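/- Let $G$ be a (possibly infinite) simple graph with edge set $E$. A \emph{separation} of $G$ is a set $X\subseteq E$, with complement $X^\complement=E\setminus X$. Let $V(X)$ be the set of vertices incident with an edge of $X$, let $\partial(X)=V(X)\cap V(X^\complement)$ be its \emph{boundary}, and call $|\partial(X)|$ the \emph{order} of $X$. Write $L(X,Y)=\bigl(V(X)\cap V(Y)\bigr)\cap\bigl(V(X^\complement)\cup V(Y^\complement)\bigr)$. A separation $X$ is \emph{componental} if there is a component $C$ of $G-\partial(X)$ such that $X$ is the set of edges with at least one endvertex in $C$. Two separations $X,Y$ are \emph{nested} if $X\subseteq Y$, $X^\complement\subseteq Y$, $Y\subseteq X$ or $Y\subseteq X^\complement$; a set of separations is nested if any two of its elements are nested. For $k\in\mathbb N=\{0,1,2,\dots\}$, a \emph{profile of order $k+1$} is a set $P$ of separations of order at most $k$ that contains no one-element set $\{e\}$ and satisfies: (P0) for each separation $X$ of order at most $k$, $X\in P$ or $X^\complement\in P$; (P1) $X\cap Y\neq\emptyset$ for all (not necessarily distinct) $X,Y\in P$; (P2) if $X,Y\in P$ and $|L(X,Y)|\le k$, then $X\cap Y\in P$; (P3) if $X\in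 P$, then there is a componental separation $Y\subseteq X$ with $Y\in P$. For $r\in\mathbb N\cup\{\infty\}$, a profile $P$ of order $k+1$ is \emph{$r$-robust} if there do not exist a separation $X$ of finite order at most $r$ and a separation $Y\in P$ of order $\ell\le k$ such that $|L(X,Y)|<\ell$, $|L(X^\complement,Y)|<\ell$, $Y\setminus X\notin P$ and $Y\setminus X^\complement\notin P$. A separation $X$ \emph{distinguishes} two profiles $P$ and $Q$ if $X\in P$ and $X^\complement\in Q$, or $X\in Q$ and $X^\complement\in P$; it does so \emph{efficiently} if its order is minimal amongst all separations distinguishing $P$ and $Q$. \textbf{Theorem.} For any graph $G$ and any $r\in\mathbb N\cup\{\infty\}$, there is a nested set $\mathcal N$ of separations of finite order such that for any two $r$-robust profiles $P,Q$ of $G$ of the same order that are distinguished by some separation of order at most $r$, there is an $X\in\mathcal N$ that distinguishes $P$ and $Q$ efficiently. (The last condition holds automatically for any two distinct profiles of the same order $k+1$ with $k\le r$; in particular, for $r=\infty$ it holds for any two distinct profiles of the same order.) -/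

import Mathlib

namespace EdgeSeparation

open Set

/-- `V(X)`: the vertices incident with an edge of `X`. A separation of `G` is an arbitrary set of
edges, i.e. a term of type `Set G.edgeSet`; complements are taken in the edge set of `G`. -/
def verts {V : Type*} {G : SimpleGraph V} (X : Set G.edgeSet) : Set V :=
  {v | ∃ e ∈ X, v ∈ (e : Sym2 V)}

/-- The boundary of `X`: the vertices incident with an edge of `X` and with an edge outside `X`. -/
def boundary {V : Type*} {G : SimpleGraph V} (X : Set G.edgeSet) : Set V :=
  verts X ∩ verts Xᶜ

/-- The order of `X`: the size of its boundary. -/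
noncomputable def order {V : Type*} {G : SimpleGraph V} (X : Set G.edgeSet) : ℕ∞ :=
  (boundary X).encard

/-- `L(X, Y)`, the intersection of `V(X) ∩ V(Y)` with `V(Xᶜ) ∪ V(Yᶜ)`. -/
def corner {V : Type*} {G : SimpleGraph V} (X Y : Set G.edgeSet) : Set V :=
  (verts X ∩ verts Y) ∩ (verts Xᶜ ∪ verts Yᶜ)

/-- `s_W`: the edges of `G` with at least one endvertex in `W`. -/
def edgesAt {V : Type*} (G : SimpleGraph V) (W : Set V) : Set G.edgeSet :=
  {e | ∃ v ∈ W, v ∈ (e : Sym2 V)}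

/-- `X` is componental: `X = s_C` for some component `C` of `G - ∂(X)`. -/
def Componental {V : Type*} {G : SimpleGraph V} (X : Set G.edgeSet) : Prop :=
  ∃ C : G.ComponentCompl (boundary X), edgesAt G C.supp = X

/-- Two separations are nested. -/
def Nested {V : Type*} {G : SimpleGraph V} (X Y : Set G.edgeSet) : Prop :=
  X ⊆ Y ∨ Xᶜ ⊆ Y ∨ Y ⊆ X ∨ Y ⊆ Xᶜ

/-- `P` is a profile of order `k + 1` in `G`. -/
structure IsProfile {V : Type*} {G : SimpleGraph V} (k : ℕ) (P : Set (Set G.edgeSet)) : Prop where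
  order_le : ∀ X ∈ P, order X ≤ k
  singleton_notMem : ∀ e : G.edgeSet, {e} ∉ P
  mem_or_compl_mem : ∀ X : Set G.edgeSet, order X ≤ k → X ∈ P ∨ Xᶜ ∈ P
  not_disjoint : ∀ X ∈ P, ∀ Y ∈ P, ¬ Disjoint X Y
  inter_mem : ∀ X ∈ P, ∀ Y ∈ P, (corner X Y).encard ≤ k → X ∩ Y ∈ P
  exists_componental : ∀ X ∈ P, ∃ Y ⊆ X, Componental Y ∧ Y ∈ P

/-- The profile `P` of order `k + 1` is `r`-robust: there are no separation `X` of finite order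
at most `r` and no `Y ∈ P` of order `ℓ ≤ k` such that `L(X, Y)` and `L(Xᶜ, Y)` have fewer than `ℓ`
elements and neither `Y \ X` nor `Y \ Xᶜ` is in `P`. -/
def IsRobust {V : Type*} {G : SimpleGraph V} (r : ℕ∞) (k : ℕ) (P : Set (Set G.edgeSet)) : Prop :=
  ¬ ∃ X Y : Set G.edgeSet, (boundary X).Finite ∧ order X ≤ r ∧ order Y ≤ k ∧
    (corner X Y).encard < order Y ∧ (corner Xᶜ Y).encard < order Y ∧
    Y ∈ P ∧ Y \ X ∉ P ∧ Y \ Xᶜ ∉ P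

/-- `X` distinguishes `P` and `Q`. -/
def Distinguishes {V : Type*} {G : SimpleGraph V} (X : Set G.edgeSet)
    (P Q : Set (Set G.edgeSet)) : Prop :=
  (X ∈ P ∧ Xᶜ ∈ Q) ∨ (X ∈ Q ∧ Xᶜ ∈ P)

/-- `X` distinguishes `P` and `Q`, with minimal order amongst all separations that do so. -/
def DistinguishesEfficiently {V : Type*} {G : SimpleGraph V} (X : Set G.edgeSet)
    (P Q : Set (Set G.edgeSet)) : Prop :=
  Distinguishes X P Q ∧ ∀ Z : Set G.edgeSet, Distinguishes Z P Q → order X ≤ order Z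

end EdgeSeparation

namespace EdgeSeparation

open Set

/-! ### Components and separators -/

section Components

variable {V : Type*} {G : SimpleGraph V} {S T U A B C D F c : Set V} {u v w : V}

/-! Efficient distinguishers are studied through their boundaries. If `X` distinguishes two profiles
with least order, each profile lives in a component of `G - ∂(X)`, and that component is full, since
otherwise its edge set would distinguish the profiles with smaller order
(`RobustPair.splits_of_mem`). Hence the boundary is a tight separator, and crossing is symmetric
between tight separators. Two things remain: to find pairwise non-crossing separators splitting all
pairs, and to turn these into nested edge sets.

The separators are chosen by increasing size. Robustness allows a separator to be uncrossed from a
smaller one (`RobustPair.exists_splits_not_crosses`). Within one size, those crossed by the fewest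
efficient separators of that size are taken; the number is finite even in an infinite graph
(`finite_tight_crosses`). If two of these crossed, submodularity would put separators of the same
size at opposite corners with a strictly smaller sum of crossing numbers (`ncard_crossing_add_lt`),
contradicting minimality. Replacements stay inside the union of the crossing pair, so by
`not_crosses_of_subset_union` they create no crossing with smaller separators already chosen.

For non-crossing `S` and `T`, the edge sets at full components `C` of `G - S` and `D` of `G - T` are
nested unless `C` meets `T` and `D` meets `S`. Discarding at each `S` only the component toward the
first separator facing it, in a well-ordering, removes all such conflicts (`Chosen.not_toward`) and
still keeps one of any two full components. -/

/-- `C` is the vertex set of a component of `G - S`. -/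
def IsComp (G : SimpleGraph V) (S C : Set V) : Prop :=
  ∃ K : G.ComponentCompl S, K.supp = C

theorem IsComp.nonempty (h : IsComp G S C) : C.Nonempty := by
  obtain ⟨K, rfl⟩ := h
  exact K.nonempty

theorem IsComp.notMem (h : IsComp G S C) (hv : v ∈ C) : v ∉ S := by
  obtain ⟨K, rfl⟩ := h
  exact K.notMem_of_mem hv

theorem IsComp.mem_of_adj (h : IsComp G S C) (hu : u ∈ C) (huv : G.Adj u v) (hv : v ∉ S) :
    v ∈ C := by
  obtain ⟨K, rfl⟩ := h
  exact K.mem_of_adj u v hu hv huv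

theorem exists_isComp (G : SimpleGraph V) (hv : v ∉ S) : ∃ C, IsComp G S C ∧ v ∈ C :=
  ⟨_, ⟨G.componentComplMk hv, rfl⟩, G.componentComplMk_mem hv⟩

theorem IsComp.subset_of_closed (h : IsComp G S C) (hvC : v ∈ C) (hvA : v ∈ A)
    (hA : ∀ x ∈ A, x ∈ C → ∀ y ∈ C, G.Adj x y → y ∈ A) : C ⊆ A := by
  obtain ⟨K, rfl⟩ := h
  intro w hw
  obtain ⟨hvS, hvK⟩ := hvC
  obtain ⟨hwS, hwK⟩ := hw
  have hr : (G.induce Sᶜ).Reachable ⟨v, hvS⟩ ⟨w, hwS⟩ :=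
    SimpleGraph.ConnectedComponent.exact (hvK.trans hwK.symm)
  rw [SimpleGraph.reachable_iff_reflTransGen] at hr
  have key : ∀ z : (Sᶜ : Set V), Relation.ReflTransGen (G.induce Sᶜ).Adj ⟨v, hvS⟩ z →
      z.1 ∈ A ∧ z.1 ∈ K.supp := by
    intro z hz
    induction hz with
    | refl => exact ⟨hvA, hvS, hvK⟩
    | @tail b d _ hbd ih =>
      have hd : d.1 ∈ K.supp := K.mem_of_adj b.1 d.1 ih.2 d.2 hbd
      exact ⟨hA _ ih.1 ih.2 _ hd hbd, hd⟩
  exact (key _ hr).1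

/-- A component of `G - S` that avoids `T` lies in every component of `G - T` that it meets. -/
theorem IsComp.subset_of_disjoint (h : IsComp G S C) (hA : IsComp G T A) (hT : Disjoint C T)
    (hC : v ∈ C) (hvA : v ∈ A) : C ⊆ A :=
  h.subset_of_closed hC hvA fun _ hx _ _ hy hxy =>
    hA.mem_of_adj hx hxy (Set.disjoint_left.1 hT hy)

theorem IsComp.eq_of_mem (hA : IsComp G S A) (hB : IsComp G S B) (ha : v ∈ A) (hb : v ∈ B) :
    A = B :=
  (hA.subset_of_disjoint hB (Set.disjoint_left.2 fun _ => hA.notMem) ha hb).antisymm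
    (hB.subset_of_disjoint hA (Set.disjoint_left.2 fun _ => hB.notMem) hb ha)

/-- `C` is a component of `G - S` in which every vertex of `S` has a neighbour. -/
def Full (G : SimpleGraph V) (S C : Set V) : Prop :=
  IsComp G S C ∧ ∀ s ∈ S, ∃ x ∈ C, G.Adj s x

/-- At least two components of `G - S` are full. -/
def Tight (G : SimpleGraph V) (S : Set V) : Prop :=
  ∃ C D, Full G S C ∧ Full G S D ∧ C ≠ D

/-- `T` separates two vertices of `S`. -/
def Crosses (G : SimpleGraph V) (T S : Set V) : Prop :=
  ∃ A B, IsComp G T A ∧ IsComp G T B ∧ A ≠ B ∧ (A ∩ S).Nonempty ∧ (B ∩ S).Nonempty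

/-- A full component avoiding `T` is connected in `G - T` and adjacent to all of `S`, so it ties the
rest of `S` to a single component of `G - T`. -/
theorem Full.absorb (hC : Full G S C) (hT : Disjoint C T) (hA : IsComp G T A)
    (h : (A ∩ S).Nonempty) : C ⊆ A ∧ S \ T ⊆ A := by
  obtain ⟨a, haA, haS⟩ := h
  obtain ⟨x, hxC, hax⟩ := hC.2 a haS
  have hCA := hC.1.subset_of_disjoint hA hT hxC
    (hA.mem_of_adj haA hax (Set.disjoint_left.1 hT hxC))
  refine ⟨hCA, fun b hb => ?_⟩
  obtain ⟨y, hyC, hby⟩ := hC.2 b hb.1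
  exact hA.mem_of_adj (hCA hyC) hby.symm hb.2

theorem Crosses.inter_full_nonempty (h : Crosses G T S) (hC : Full G S C) : (C ∩ T).Nonempty := by
  obtain ⟨A, B, hA, hB, hne, hAS, b, hbB, hbS⟩ := h
  rw [← Set.not_disjoint_iff_nonempty_inter]
  intro hd
  exact hne (hA.eq_of_mem hB ((hC.absorb hd hA hAS).2 ⟨hbS, hB.notMem hbB⟩) hbB)

theorem Crosses.symm (h : Crosses G T S) (hS : Tight G S) : Crosses G S T := by
  obtain ⟨C, D, hC, hD, hne⟩ := hS
  exact ⟨C, D, hC.1, hD.1, hne, h.inter_full_nonempty hC, h.inter_full_nonempty hD⟩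

theorem mem_or_mem_of_not_crosses (h : ¬ Crosses G T S) (hA : IsComp G T A)
    (hAS : (A ∩ S).Nonempty) (hv : v ∈ S) : v ∈ T ∨ v ∈ A := by
  by_contra! hn
  obtain ⟨B, hB, hvB⟩ := exists_isComp G hn.1
  exact h ⟨A, B, hA, hB, fun hAB => hn.2 (hAB ▸ hvB), hAS, v, hvB, hv⟩

theorem not_crosses_union_aux (hS : Tight G S) (hT : Tight G T) (hU : Tight G U)
    (h : Crosses G T S) (hUS : ¬ Crosses G U S) (hUT : ¬ Crosses G U T)
    (hA : IsComp G U A) (hB : IsComp G U B) (hne : A ≠ B) (hAS : (A ∩ S).Nonempty)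
    (hBT : (B ∩ T).Nonempty) : False := by
  have hTA : Disjoint A T := by
    rw [Set.disjoint_iff_inter_eq_empty, ← Set.not_nonempty_iff_eq_empty]
    exact fun hAT => hUT ⟨A, B, hA, hB, hne, hAT, hBT⟩
  have hTU : ¬ Crosses G T U := fun h' => hUT (h'.symm hU)
  have hst := h.symm hS
  obtain ⟨F₁, F₂, h₁, h₂, hF⟩ := hT
  -- Since `T` does not cross `U`, the component `F'` avoids `U` and hence lies in `A`. Being full,
  -- it has a neighbour of a vertex of `B ∩ T`, which joins `A` to `B`.
  have mixed : ∀ F F' s s', Full G T F → Full G T F' → F ≠ F' → s ∈ F → s ∈ U → s' ∈ F' →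
      s' ∈ A → False := by
    intro F F' s s' hF hF' hne' hs hsU hs' hsA
    have hd : Disjoint F' U := by
      rw [Set.disjoint_iff_inter_eq_empty, ← Set.not_nonempty_iff_eq_empty]
      exact fun hn => hTU ⟨F, F', hF.1, hF'.1, hne', ⟨s, hs, hsU⟩, hn⟩
    have hsub : F' ⊆ A := hF'.1.subset_of_disjoint hA hd hs' hsA
    obtain ⟨b, hbB, hbT⟩ := hBT
    obtain ⟨x, hx, hbx⟩ := hF'.2 b hbT
    exact hne (hA.eq_of_mem hB (hA.mem_of_adj (hsub hx) hbx.symm (hB.notMem hbB)) hbB)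
  obtain ⟨s₁, hs₁, hsS₁⟩ := hst.inter_full_nonempty h₁
  obtain ⟨s₂, hs₂, hsS₂⟩ := hst.inter_full_nonempty h₂
  -- Each `sᵢ` lies in `U` or in `A`. Both in `U` makes `T` cross `U`; both in `A` joins `F₁` to
  -- `F₂`, because `A` is connected and avoids `T`.
  rcases mem_or_mem_of_not_crosses hUS hA hAS hsS₁ with h1 | h1 <;>
    rcases mem_or_mem_of_not_crosses hUS hA hAS hsS₂ with h2 | h2
  · exact hTU ⟨F₁, F₂, h₁.1, h₂.1, hF, ⟨s₁, hs₁, h1⟩, ⟨s₂, hs₂, h2⟩⟩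
  · exact mixed F₁ F₂ s₁ s₂ h₁ h₂ hF hs₁ h1 hs₂ h2
  · exact mixed F₂ F₁ s₂ s₁ h₂ h₁ hF.symm hs₂ h2 hs₁ h1
  · exact hF (h₁.1.eq_of_mem h₂.1 (hA.subset_of_disjoint h₁.1 hTA h1 hs₁ h1)
      (hA.subset_of_disjoint h₂.1 hTA h2 hs₂ h1))

/-- A tight separator that crosses neither of two crossing tight separators crosses no subset of
their union. -/
theorem not_crosses_of_subset_union (hS : Tight G S) (hT : Tight G T) (hU : Tight G U)
    (h : Crosses G T S) (hUS : ¬ Crosses G U S) (hUT : ¬ Crosses G U T) (hc : c ⊆ S ∪ T) :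
    ¬ Crosses G U c := by
  rintro ⟨A, B, hA, hB, hne, ⟨a, haA, hac⟩, b, hbB, hbc⟩
  rcases hc hac with ha | ha <;> rcases hc hbc with hb | hb
  · exact hUS ⟨A, B, hA, hB, hne, ⟨a, haA, ha⟩, b, hbB, hb⟩
  · exact not_crosses_union_aux hS hT hU h hUS hUT hA hB hne ⟨a, haA, ha⟩ ⟨b, hbB, hb⟩
  · exact not_crosses_union_aux hS hT hU h hUS hUT hB hA hne.symm ⟨b, hbB, hb⟩ ⟨a, haA, ha⟩
  · exact hUT ⟨A, B, hA, hB, hne, ⟨a, haA, ha⟩, b, hbB, hb⟩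

/-! ### Finitely many tight separators of a given size cross a finite one -/

/-- `F` plays the role of the vertex set of a path from `u` to `v` in `G - W`: every set separating
them there must meet it. -/
theorem IsComp.exists_finite_connector {W : Set V} (hK : IsComp G W C) (hu : u ∈ C) (hv : v ∈ C) :
    ∃ F : Set V, F.Finite ∧ ∀ T, Disjoint F T → ∀ A, IsComp G (T ∪ W) A → u ∈ A → v ∈ A := by
  refine hK.subset_of_closed (A := {v | ∃ F : Set V, F.Finite ∧ ∀ T, Disjoint F T →
    ∀ A, IsComp G (T ∪ W) A → u ∈ A → v ∈ A}) hu
    ⟨∅, Set.finite_empty, fun _ _ _ _ h => h⟩ ?_ hv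
  rintro x ⟨F, hF, h⟩ - y hy hxy
  refine ⟨insert y F, hF.insert y, fun T hT A hA huA => ?_⟩
  rw [Set.disjoint_insert_left] at hT
  exact hA.mem_of_adj (h T hT.2 A hA huA) hxy (by
    rintro (h' | h')
    exacts [hT.1 h', hK.notMem hy h'])

/-- `T` is inclusion-minimal among the sets separating `u` from `v` in `G - W`. -/
def MinSeparates (G : SimpleGraph V) (u v : V) (W T : Set V) : Prop :=
  ∃ A B, IsComp G (T ∪ W) A ∧ IsComp G (T ∪ W) B ∧ A ≠ B ∧ u ∈ A ∧ v ∈ B ∧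
    ∀ t ∈ T, (∃ x ∈ A, G.Adj t x) ∧ ∃ x ∈ B, G.Adj t x

/-- Induction on `n`: a separating set meets a fixed finite connector in some `w`, and moving `w`
from `T` to `W` leaves `G - (T ∪ W)`, and so `A` and `B`, unchanged. The general `W` is there for
this step. -/
theorem finite_minSeparates (G : SimpleGraph V) (u v : V) (n : ℕ) (W : Set V) :
    {T : Set V | T.encard = n ∧ Disjoint T W ∧ MinSeparates G u v W T}.Finite := by
  induction n generalizing W with
  | zero =>
    refine (Set.finite_singleton (∅ : Set V)).subset fun T hT => ?_
    simpa using hT.1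
  | succ n ih =>
    by_cases hconn : ∃ C, IsComp G W C ∧ u ∈ C ∧ v ∈ C
    · obtain ⟨C, hC, hu, hv⟩ := hconn
      obtain ⟨F, hF, h⟩ := hC.exists_finite_connector hu hv
      refine (hF.biUnion fun w _ => (ih (insert w W)).image (insert w)).subset ?_
      rintro T ⟨hTn, hTW, A, B, hA, hB, hne, huA, hvB, hadj⟩
      have hFT : ¬ Disjoint F T := fun hd => hne (hA.eq_of_mem hB (h T hd A hA huA) hvB)
      obtain ⟨w, hwF, hwT⟩ := Set.not_disjoint_iff.1 hFT
      have hins : insert w (T \ {w}) = T := by simp [Set.insert_eq_of_mem hwT]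
      have hun : T \ {w} ∪ insert w W = T ∪ W := by
        ext x
        by_cases hx : x = w
        · subst hx; simp [hwT]
        · simp [hx]
      refine Set.mem_biUnion hwF ⟨T \ {w}, ⟨?_, ?_, A, B, ?_⟩, hins⟩
      · have h1 := Set.encard_sdiff_singleton_add_one hwT
        rw [hTn] at h1
        push_cast at h1
        exact ENat.add_left_injective_of_ne_top ENat.one_ne_top h1
      · rw [Set.disjoint_insert_right]
        exact ⟨by simp, hTW.mono_left Set.sdiff_subset⟩
      · rw [hun]
        exact ⟨hA, hB, hne, huA, hvB, fun t ht => hadj t ht.1⟩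
    -- If `u` and `v` are already separated by `W`, no vertex `t` can be adjacent to both sides, so
    -- a nonempty `T` is never minimal.
    · refine Set.finite_empty.subset ?_
      rintro T ⟨hTn, hTW, A, B, hA, hB, hne, huA, hvB, hadj⟩
      have hT : T.Nonempty := by
        rw [← Set.encard_ne_zero, hTn]
        exact_mod_cast Nat.succ_ne_zero n
      obtain ⟨t, ht⟩ := hT
      obtain ⟨⟨x, hx, htx⟩, y, hy, hty⟩ := hadj t ht
      obtain ⟨C, hC, htC⟩ := exists_isComp G (Set.disjoint_left.1 hTW ht)
      have sub : ∀ E, IsComp G (T ∪ W) E → ∀ x ∈ E, G.Adj t x → E ⊆ C := by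
        intro E hE x hx htx
        have hEW : ∀ z ∈ E, z ∉ W := fun z hz hzW => hE.notMem hz (Or.inr hzW)
        exact hE.subset_of_disjoint hC (Set.disjoint_left.2 hEW) hx
          (hC.mem_of_adj htC htx (hEW x hx))
      exact hconn ⟨C, hC, sub A hA x hx htx huA, sub B hB y hy hty hvB⟩

theorem finite_tight_crosses (hS : S.Finite) (hSt : Tight G S) (n : ℕ) :
    {U : Set V | Tight G U ∧ U.encard = n ∧ Crosses G U S}.Finite := by
  refine (hS.biUnion fun u _ => hS.biUnion fun v _ => finite_minSeparates G u v n ∅).subset ?_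
  rintro U ⟨hU, hn, h⟩
  have hSU : ∀ C, Full G U C → (C ∩ S).Nonempty :=
    fun C hC => (h.symm hSt).inter_full_nonempty hC
  obtain ⟨C, D, hC, hD, hne⟩ := hU
  obtain ⟨u, huC, hu⟩ := hSU C hC
  obtain ⟨v, hvD, hv⟩ := hSU D hD
  refine Set.mem_biUnion hu (Set.mem_biUnion hv ⟨hn, Set.disjoint_empty _, C, D, ?_⟩)
  rw [Set.union_empty]
  exact ⟨hC.1, hD.1, hne, huC, hvD, fun t ht => ⟨hC.2 t ht, hD.2 t ht⟩⟩

end Components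

/-! ### Edges at a component -/

section Edges

variable {V : Type*} {G : SimpleGraph V} {S T U C D E E' c : Set V} {u v w : V}
  {X Y Z : Set G.edgeSet} {e : G.edgeSet}

theorem adj_of_mem_edge (hv : v ∈ (e : Sym2 V)) (hw : w ∈ (e : Sym2 V)) (hne : v ≠ w) :
    G.Adj v w := by
  have h := (Sym2.mem_and_mem_iff hne).1 ⟨hv, hw⟩
  have he := e.2
  rwa [h, SimpleGraph.mem_edgeSet] at he

theorem exists_edge_of_adj (h : G.Adj v w) :
    ∃ e : G.edgeSet, v ∈ (e : Sym2 V) ∧ w ∈ (e : Sym2 V) :=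
  ⟨⟨s(v, w), h⟩, Sym2.mem_mk_left v w, Sym2.mem_mk_right v w⟩

theorem boundary_compl (X : Set G.edgeSet) : boundary Xᶜ = boundary X := by
  rw [boundary, boundary, compl_compl, Set.inter_comm]

theorem order_compl (X : Set G.edgeSet) : order Xᶜ = order X := by
  rw [order, order, boundary_compl]

theorem verts_mono (h : X ⊆ Y) : verts X ⊆ verts Y :=
  fun _ ⟨e, he, hv⟩ => ⟨e, h he, hv⟩

theorem edgesAt_mono (h : C ⊆ D) : edgesAt G C ⊆ edgesAt G D :=
  fun _ ⟨v, hv, he⟩ => ⟨v, h hv, he⟩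

theorem verts_union (X Y : Set G.edgeSet) : verts (X ∪ Y) = verts X ∪ verts Y := by
  ext v
  simp only [verts, Set.mem_union, Set.mem_ofPred_eq, or_and_right, exists_or]

theorem boundary_inter_subset_corner (X Y : Set G.edgeSet) : boundary (X ∩ Y) ⊆ corner X Y := by
  rintro v ⟨h1, h2⟩
  rw [Set.compl_inter, verts_union] at h2
  exact ⟨⟨verts_mono Set.inter_subset_left h1, verts_mono Set.inter_subset_right h1⟩, h2⟩

theorem order_inter_le (X Y : Set G.edgeSet) : order (X ∩ Y) ≤ (corner X Y).encard :=
  Set.encard_le_encard (boundary_inter_subset_corner X Y)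

theorem boundary_inter_subset_union (X Y : Set G.edgeSet) :
    boundary (X ∩ Y) ⊆ boundary X ∪ boundary Y := by
  intro v hv
  obtain ⟨⟨h1, h2⟩, h3 | h3⟩ := boundary_inter_subset_corner X Y hv
  exacts [Or.inl ⟨h1, h3⟩, Or.inr ⟨h2, h3⟩]

theorem corner_comm (X Y : Set G.edgeSet) : corner X Y = corner Y X := by
  rw [corner, corner, Set.inter_comm (verts X), Set.union_comm (verts Xᶜ)]

/-- Submodularity, stated for `corner` rather than for the boundary of the intersection because (P2)
and robustness are phrased with `corner`. -/
theorem encard_corner_add_le (X Y : Set G.edgeSet) :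
    (corner X Y).encard + (corner Xᶜ Yᶜ).encard ≤ order X + order Y := by
  rw [order, order, ← Set.encard_union_add_encard_inter (corner X Y),
    ← Set.encard_union_add_encard_inter (boundary X)]
  refine add_le_add (Set.encard_le_encard ?_) (Set.encard_le_encard ?_)
  · rintro v (⟨⟨h1, h2⟩, h3 | h3⟩ | ⟨⟨h1, h2⟩, h3 | h3⟩)
    · exact Or.inl ⟨h1, h3⟩
    · exact Or.inr ⟨h2, h3⟩
    · rw [compl_compl] at h3
      exact Or.inl ⟨h3, h1⟩
    · rw [compl_compl] at h3
      exact Or.inr ⟨h3, h2⟩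
  · rintro v ⟨⟨⟨h1, h2⟩, -⟩, ⟨h3, h4⟩, -⟩
    exact ⟨⟨h1, h3⟩, h2, h4⟩

theorem IsComp.mem_of_mem_edge (hC : IsComp G S C) (hu : u ∈ C) (hue : u ∈ (e : Sym2 V))
    (hve : v ∈ (e : Sym2 V)) (hv : v ∉ S) : v ∈ C := by
  by_cases h : u = v
  · exact h ▸ hu
  · exact hC.mem_of_adj hu (adj_of_mem_edge hue hve h) hv

theorem IsComp.verts_edgesAt_subset (hC : IsComp G S C) : verts (edgesAt G C) ⊆ C ∪ S := by
  rintro v ⟨e, ⟨u, hu, hue⟩, hve⟩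
  by_cases hv : v ∈ S
  exacts [Or.inr hv, Or.inl (hC.mem_of_mem_edge hu hue hve hv)]

theorem notMem_verts_compl_edgesAt (hv : v ∈ C) : v ∉ verts (edgesAt G C)ᶜ :=
  fun ⟨_, he, hve⟩ => he ⟨v, hv, hve⟩

theorem IsComp.boundary_edgesAt_subset (hC : IsComp G S C) : boundary (edgesAt G C) ⊆ S := by
  rintro v ⟨h1, h2⟩
  exact (hC.verts_edgesAt_subset h1).resolve_left fun h => notMem_verts_compl_edgesAt h h2

theorem IsComp.order_edgesAt_le (hC : IsComp G S C) : order (edgesAt G C) ≤ S.encard :=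
  Set.encard_le_encard hC.boundary_edgesAt_subset

theorem IsComp.disjoint_edgesAt (hC : IsComp G S C) (hD : IsComp G S D) (hne : C ≠ D) :
    Disjoint (edgesAt G C) (edgesAt G D) := by
  rw [Set.disjoint_left]
  rintro e ⟨u, hu, hue⟩ ⟨v, hv, hve⟩
  exact hne (hC.eq_of_mem hD (hC.mem_of_mem_edge hu hue hve (hD.notMem hv)) hv)

theorem Full.boundary_edgesAt (hC : Full G S C) (hD : Full G S D) (hne : C ≠ D) :
    boundary (edgesAt G C) = S := by
  refine hC.1.boundary_edgesAt_subset.antisymm fun s hs => ?_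
  obtain ⟨x, hx, hsx⟩ := hC.2 s hs
  obtain ⟨y, hy, hsy⟩ := hD.2 s hs
  obtain ⟨e, hse, hxe⟩ := exists_edge_of_adj hsx
  obtain ⟨f, hsf, hyf⟩ := exists_edge_of_adj hsy
  exact ⟨⟨e, ⟨x, hx, hxe⟩, hse⟩, f,
    Set.disjoint_right.1 (hC.1.disjoint_edgesAt hD.1 hne) ⟨y, hy, hyf⟩, hsf⟩

/-- `X` is one of the two separations given by a full component of `G - S`, for tight `S`. -/
def Side (G : SimpleGraph V) (S : Set V) (X : Set G.edgeSet) : Prop :=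
  ∃ C D, Full G S C ∧ Full G S D ∧ C ≠ D ∧ (X = edgesAt G C ∨ X = (edgesAt G C)ᶜ)

theorem Side.compl (h : Side G S X) : Side G S Xᶜ := by
  obtain ⟨C, D, hC, hD, hne, rfl | rfl⟩ := h
  exacts [⟨C, D, hC, hD, hne, Or.inr rfl⟩, ⟨C, D, hC, hD, hne, Or.inl (compl_compl _)⟩]

theorem Side.boundary_eq (h : Side G S X) : boundary X = S := by
  obtain ⟨C, D, hC, hD, hne, rfl | rfl⟩ := h
  · exact hC.boundary_edgesAt hD hne
  · rw [boundary_compl, hC.boundary_edgesAt hD hne]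

theorem Side.not_crosses (h : Side G S X) (hc : c ⊆ verts X) : ¬ Crosses G c S := by
  obtain ⟨C, D, hC, hD, hne, rfl | rfl⟩ := h
  · intro h
    obtain ⟨x, hxD, hxc⟩ := h.inter_full_nonempty hD
    rcases hC.1.verts_edgesAt_subset (hc hxc) with hx | hx
    exacts [hne (hC.1.eq_of_mem hD.1 hx hxD), hD.1.notMem hxD hx]
  · intro h
    obtain ⟨x, hxC, hxc⟩ := h.inter_full_nonempty hC
    exact notMem_verts_compl_edgesAt hxC (hc hxc)

theorem disjoint_boundary_of_edgesAt_subset (hX : edgesAt G E ⊆ X) : Disjoint E (boundary X) := by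
  rw [Set.disjoint_left]
  rintro v hv ⟨-, e, he, hve⟩
  exact he (hX ⟨v, hv, hve⟩)

/-- A separator not crossed by `S` misses, on one of the two sides of `S`, all components whose
edges lie on that side. -/
theorem Side.disjoint_or_disjoint {c c' : Set V} (h : Side G S X) (hU : ¬ Crosses G S U)
    (hE : IsComp G c E) (hEX : edgesAt G E ⊆ X) (hEn : (edgesAt G E).Nonempty)
    (hE' : IsComp G c' E') (hEX' : edgesAt G E' ⊆ Xᶜ) (hEn' : (edgesAt G E').Nonempty) :
    Disjoint E U ∨ Disjoint E' U := by
  have hb := h.boundary_eq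
  obtain ⟨C, D, hC, hD, hne, hX⟩ := h
  -- Nonemptiness of the edge set is needed: an isolated vertex gives an empty edge set, which is
  -- contained in both sides.
  have inside : ∀ c E, IsComp G c E → (edgesAt G E).Nonempty → edgesAt G E ⊆ edgesAt G C →
      Disjoint E S → E ⊆ C := by
    rintro c E hE ⟨e, v, hv, hve⟩ hEC hES
    obtain ⟨w, hw, hwe⟩ := hEC ⟨v, hv, hve⟩
    exact hE.subset_of_disjoint hC.1 hES hv
      (hC.1.mem_of_mem_edge hw hwe hve (Set.disjoint_left.1 hES hv))
  have outside : ∀ c E, IsComp G c E → (edgesAt G E).Nonempty → edgesAt G E ⊆ (edgesAt G C)ᶜ →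
      Disjoint E S → Disjoint E (C ∪ S) := by
    rintro c E hE ⟨e, he⟩ hEC hES
    rw [Set.disjoint_union_right]
    refine ⟨Set.disjoint_left.2 fun v hvE hvC => ?_, hES⟩
    exact hEC he (edgesAt_mono (hE.subset_of_disjoint hC.1 hES hvE hvC) he)
  have key : ∀ c c' E E', IsComp G c E → (edgesAt G E).Nonempty → edgesAt G E ⊆ edgesAt G C →
      Disjoint E S → IsComp G c' E' → (edgesAt G E').Nonempty →
      edgesAt G E' ⊆ (edgesAt G C)ᶜ → Disjoint E' S → Disjoint E U ∨ Disjoint E' U := by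
    intro c c' E E' h1 h2 h3 h4 h5 h6 h7 h8
    -- If `U` meets `C`, then `U ⊆ C ∪ S` as `S` does not cross `U`, and the outer component misses
    -- it; otherwise the inner one does.
    by_cases hCU : Disjoint C U
    · exact Or.inl (hCU.mono_left (inside c E h1 h2 h3 h4))
    · rw [Set.not_disjoint_iff_nonempty_inter] at hCU
      refine Or.inr ((outside c' E' h5 h6 h7 h8).mono_right fun v hv => ?_)
      exact (mem_or_mem_of_not_crosses hU hC.1 hCU hv).symm
  have hES : Disjoint E S := hb ▸ disjoint_boundary_of_edgesAt_subset hEX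
  have hES' : Disjoint E' S := by
    rw [← hb, ← boundary_compl]
    exact disjoint_boundary_of_edgesAt_subset hEX'
  rcases hX with rfl | rfl
  · exact key c c' E E' hE hEn hEX hES hE' hEn' hEX' hES'
  · rw [compl_compl] at hEX'
    exact (key c' c E' E hE' hEn' hEX' hES' hE hEn hEX hES).symm

end Edges

/-! ### Profiles -/

section Profiles

variable {V : Type*} {G : SimpleGraph V} {S T U C D E c : Set V} {X Y Z : Set G.edgeSet}
  {P Q P' Q' : Set (Set G.edgeSet)} {k k' l l' : ℕ} {r : ℕ∞}

theorem IsProfile.nonempty (hP : IsProfile k P) (hX : X ∈ P) : X.Nonempty := by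
  rw [Set.nonempty_iff_ne_empty]
  rintro rfl
  exact hP.not_disjoint _ hX _ hX (Set.disjoint_empty _)

theorem IsProfile.compl_mem (hP : IsProfile k P) (hX : X ∈ P) (hXY : Disjoint X Y)
    (hY : order Y ≤ k) : Yᶜ ∈ P :=
  (hP.mem_or_compl_mem Y hY).resolve_left fun h => hP.not_disjoint _ hX _ h hXY

theorem IsProfile.superset_mem (hP : IsProfile k P) (hX : X ∈ P) (hXY : X ⊆ Y)
    (hY : order Y ≤ k) : Y ∈ P := by
  rw [← compl_compl Y]
  exact hP.compl_mem hX (Set.disjoint_compl_right_iff_subset.2 hXY) (by rwa [order_compl])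

/-- (P3) only gives a component relative to the boundary of `Y`. That component avoids `∂(X)`, so it
grows to a component of `G - ∂(X)`, whose edges still all lie in `X`. -/
theorem IsProfile.exists_isComp (hP : IsProfile k P) (hX : X ∈ P) :
    ∃ C, IsComp G (boundary X) C ∧ edgesAt G C ∈ P ∧ edgesAt G C ⊆ X := by
  obtain ⟨Y, hYX, ⟨K, hK⟩, hYP⟩ := hP.exists_componental X hX
  have hD : IsComp G (boundary Y) K.supp := ⟨K, rfl⟩
  set D := K.supp
  have hDX : Disjoint D (boundary X) := disjoint_boundary_of_edgesAt_subset (hK.le.trans hYX)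
  obtain ⟨e, he⟩ := hP.nonempty hYP
  obtain ⟨d, hd, hde⟩ : e ∈ edgesAt G D := hK ▸ he
  obtain ⟨C, hC, hdC⟩ := EdgeSeparation.exists_isComp G (Set.disjoint_left.1 hDX hd)
  have hsub : Y ⊆ edgesAt G C := hK ▸ edgesAt_mono (hD.subset_of_disjoint hC hDX hd hdC)
  have hCX : C ⊆ verts X := by
    refine hC.subset_of_closed hdC ⟨e, hYX he, hde⟩ fun x hxX hxC y hy hxy => ?_
    obtain ⟨f, hxf, hyf⟩ := exists_edge_of_adj hxy
    exact ⟨f, by_contra fun hf => hC.notMem hxC ⟨hxX, f, hf, hxf⟩, hyf⟩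
  refine ⟨C, hC, hP.superset_mem hYP hsub (hC.order_edgesAt_le.trans (hP.order_le X hX)), ?_⟩
  rintro f ⟨x, hx, hxf⟩
  exact by_contra fun hf => hC.notMem hx ⟨hCX hx, f, hf, hxf⟩

theorem Distinguishes.symm (h : Distinguishes X P Q) : Distinguishes X Q P :=
  Or.symm h

/-- `P` and `Q` are robust profiles of order `k + 1` that no separation of order less than `l`
distinguishes, where `l ≤ k` and `l ≤ r`. -/
structure RobustPair (r : ℕ∞) (k l : ℕ) (P Q : Set (Set G.edgeSet)) : Prop where
  left : IsProfile k P
  right : IsProfile k Q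
  robust_left : IsRobust r k P
  robust_right : IsRobust r k Q
  le : l ≤ k
  le_robust : (l : ℕ∞) ≤ r
  le_order : ∀ Z, Distinguishes Z P Q → l ≤ order Z

theorem RobustPair.symm (h : RobustPair r k l P Q) : RobustPair r k l Q P :=
  ⟨h.right, h.left, h.robust_right, h.robust_left, h.le, h.le_robust,
    fun Z hZ => h.le_order Z hZ.symm⟩

/-- `S` has size `l` and `P` and `Q` live in different full components of `G - S`. -/
def Splits (l : ℕ) (P Q : Set (Set G.edgeSet)) (S : Set V) : Prop :=
  S.encard = l ∧ ∃ C D, Full G S C ∧ Full G S D ∧ C ≠ D ∧ edgesAt G C ∈ P ∧ edgesAt G D ∈ Q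

theorem Splits.symm (h : Splits l P Q S) : Splits l Q P S := by
  obtain ⟨hn, C, D, hC, hD, hne, hP, hQ⟩ := h
  exact ⟨hn, D, C, hD, hC, hne.symm, hQ, hP⟩

theorem Splits.tight (h : Splits l P Q S) : Tight G S := by
  obtain ⟨-, C, D, hC, hD, hne, -⟩ := h
  exact ⟨C, D, hC, hD, hne⟩

theorem Splits.exists_side (h : Splits l P Q S) (hPQ : RobustPair r k l P Q) :
    ∃ X, Side G S X ∧ X ∈ P ∧ Xᶜ ∈ Q := by
  obtain ⟨hn, C, D, hC, hD, hne, hP, hQ⟩ := h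
  refine ⟨_, ⟨C, D, hC, hD, hne, Or.inl rfl⟩, hP, hPQ.right.compl_mem hQ
    (hD.1.disjoint_edgesAt hC.1 hne.symm) (hC.1.order_edgesAt_le.trans ?_)⟩
  rw [hn]
  exact_mod_cast hPQ.le

theorem full_of_order_le (hC : IsComp G S C) (hfin : S.Finite)
    (h : S.encard ≤ order (edgesAt G C)) : Full G S C := by
  have heq : boundary (edgesAt G C) = S :=
    (hfin.subset hC.boundary_edgesAt_subset).eq_of_subset_of_encard_le
      hC.boundary_edgesAt_subset h
  refine ⟨hC, fun s hs => ?_⟩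
  obtain ⟨e, ⟨x, hx, hxe⟩, hse⟩ := (heq ▸ hs : s ∈ boundary (edgesAt G C)).1
  exact ⟨x, hx, adj_of_mem_edge hse hxe fun h => hC.notMem hx (h ▸ hs)⟩

theorem RobustPair.splits_of_mem (hPQ : RobustPair r k l P Q) (hP : X ∈ P) (hQ : Xᶜ ∈ Q)
    (hX : order X ≤ l) : order X = l ∧ ∃ C D, Full G (boundary X) C ∧ Full G (boundary X) D ∧
      edgesAt G C ∈ P ∧ edgesAt G D ∈ Q ∧ edgesAt G C ⊆ X ∧ edgesAt G D ⊆ Xᶜ := by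
  have hl : order X = l := hX.antisymm (hPQ.le_order X (Or.inl ⟨hP, hQ⟩))
  have hfin : (boundary X).Finite := Set.finite_of_encard_le_coe hX
  have hlk : (l : ℕ∞) ≤ k := by exact_mod_cast hPQ.le
  obtain ⟨C, hC, hCP, hCX⟩ := hPQ.left.exists_isComp hP
  obtain ⟨D, hD, hDQ, hDX⟩ := hPQ.right.exists_isComp hQ
  rw [boundary_compl] at hD
  have hCk := hC.order_edgesAt_le.trans (hX.trans hlk)
  have hDk := hD.order_edgesAt_le.trans (hX.trans hlk)
  have hCQ := hPQ.right.compl_mem hQ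
    (Set.disjoint_compl_left_iff_subset.2 hCX) hCk
  have hDP := hPQ.left.compl_mem hP (Set.subset_compl_iff_disjoint_left.1 hDX) hDk
  refine ⟨hl, C, D, full_of_order_le hC hfin (hX.trans (hPQ.le_order _ (Or.inl ⟨hCP, hCQ⟩))),
    full_of_order_le hD hfin (hX.trans (hPQ.le_order _ (Or.inr ⟨hDQ, hDP⟩))),
    hCP, hDQ, hCX, hDX⟩

/-- The boundary of an efficient distinguisher `X` splits the two profiles, and some full component
with nonempty edge set lies in `X`. -/
theorem RobustPair.splits_boundary (hPQ : RobustPair r k l P Q) (h : Distinguishes X P Q)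
    (hX : order X ≤ l) : Splits l P Q (boundary X) ∧
      ∃ E, Full G (boundary X) E ∧ edgesAt G E ⊆ X ∧ (edgesAt G E).Nonempty := by
  have main : ∀ {P Q}, RobustPair r k l P Q → X ∈ P → Xᶜ ∈ Q → Splits l P Q (boundary X) ∧
      ∃ E, Full G (boundary X) E ∧ edgesAt G E ⊆ X ∧ (edgesAt G E).Nonempty := by
    intro P Q hPQ hP hQ
    obtain ⟨hl, C, D, hC, hD, hCP, hDQ, hCX, hDX⟩ := hPQ.splits_of_mem hP hQ hX
    refine ⟨⟨hl, C, D, hC, hD, ?_, hCP, hDQ⟩, C, hC, hCX, hPQ.left.nonempty hCP⟩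
    rintro rfl
    obtain ⟨e, he⟩ := hPQ.left.nonempty hCP
    exact hDX he (hCX he)
  rcases h with ⟨hP, hQ⟩ | ⟨hQ, hP⟩
  · exact main hPQ hP hQ
  · obtain ⟨h1, h2⟩ := main hPQ.symm hQ hP
    exact ⟨h1.symm, h2⟩

theorem RobustPair.exists_splits (hPQ : RobustPair r k l P Q) (h : Distinguishes X P Q)
    (hX : order X ≤ l) : ∃ S, Splits l P Q S :=
  ⟨_, (hPQ.splits_boundary h hX).1⟩

end Profiles

/-! ### Uncrossing -/

section Uncrossing

variable {V : Type*} {G : SimpleGraph V} {S T U C D E c : Set V} {X Y Z : Set G.edgeSet}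
  {P Q P' Q' : Set (Set G.edgeSet)} {k k' l l' : ℕ} {r : ℕ∞}

theorem Splits.order_eq (h : Splits l P Q S) (hX : Side G S X) : order X = l := by
  rw [order, hX.boundary_eq, h.1]

/-- Both `P'` and `Q'` contain `X`, as its order is too small to distinguish them. If a corner on
the side of `X` has size at most `l'`, it yields the new separator. Otherwise submodularity makes
both corners on the side of `Xᶜ` smaller than `l`, contrary to the robustness of `P`. -/
theorem RobustPair.exists_splits_not_crosses_of_mem (hPQ : RobustPair r k l P Q)
    (hPQ' : RobustPair r k' l' P' Q') (hlt : l < l') (hS : Splits l P Q S)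
    (hT : Splits l' P' Q' T) (hX : Side G S X) (hXP : Xᶜ ∈ P) (hXQ : X ∈ Q) (hXP' : X ∈ P') :
    ∃ c, Splits l' P' Q' c ∧ c ⊆ S ∪ T ∧ ¬ Crosses G S c := by
  have hXl := hS.order_eq hX
  have hll : (l : ℕ∞) < l' := by exact_mod_cast hlt
  have hlk : (l : ℕ∞) ≤ k := by exact_mod_cast hPQ.le
  have hlk' : (l' : ℕ∞) ≤ k' := by exact_mod_cast hPQ'.le
  have hXQ' : X ∈ Q' := by
    refine (hPQ'.right.mem_or_compl_mem X (hXl.trans_le (hll.le.trans hlk'))).resolve_right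
      fun h => ?_
    exact (hXl.symm ▸ hPQ'.le_order X (Or.inl ⟨hXP', h⟩)).not_gt hll
  have step : ∀ {P' Q' Y}, RobustPair r k' l' P' Q' → Side G T Y → X ∈ P' → Y ∈ P' → Yᶜ ∈ Q' →
      (corner X Y).encard ≤ l' → ∃ c, Splits l' P' Q' c ∧ c ⊆ S ∪ T ∧ ¬ Crosses G S c := by
    intro P' Q' Y hPQ' hY h1 h2 h3 h4
    have ho := (order_inter_le X Y).trans h4
    have hdist : Distinguishes (X ∩ Y) P' Q' :=
      Or.inl ⟨hPQ'.left.inter_mem _ h1 _ h2 (h4.trans hlk'), hPQ'.right.compl_mem h3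
        (Set.disjoint_compl_left_iff_subset.2 Set.inter_subset_right) (ho.trans hlk')⟩
    have hc := (hPQ'.splits_boundary hdist ho).1
    refine ⟨_, hc, ?_, fun h => ?_⟩
    · rw [← hX.boundary_eq, ← hY.boundary_eq]
      exact boundary_inter_subset_union X Y
    · exact hX.not_crosses (Set.inter_subset_left.trans (verts_mono Set.inter_subset_left))
        (h.symm hc.tight)
  obtain ⟨Y, hY, hYP', hYQ'⟩ := hT.exists_side hPQ'
  have hYl := hT.order_eq hY
  by_cases h1 : (corner X Y).encard ≤ l'
  · exact step hPQ' hY hXP' hYP' hYQ' h1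
  by_cases h2 : (corner X Yᶜ).encard ≤ l'
  · obtain ⟨c, hc, hc'⟩ := step hPQ'.symm hY.compl hXQ' hYQ' (by rwa [compl_compl]) h2
    exact ⟨c, hc.symm, hc'⟩
  exfalso
  have small : ∀ Y : Set G.edgeSet, order Y = l' → ¬ (corner X Y).encard ≤ l' →
      (corner Xᶜ Yᶜ).encard < l := by
    intro Y hY h
    by_contra! hn
    have hsum := encard_corner_add_le X Y
    rw [hXl, hY, add_comm (l : ℕ∞)] at hsum
    exact (ENat.add_lt_add_of_lt_of_le (by simp) (not_le.1 h) hn).not_ge hsum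
  have h1' := small Y hYl h1
  have h2' := small Yᶜ (by rw [order_compl, hYl]) h2
  have low : ∀ Y : Set G.edgeSet, (corner Xᶜ Y).encard < l → Xᶜ ∩ Y ∉ P := by
    intro Y hY hP
    have ho := (order_inter_le Xᶜ Y).trans_lt hY
    exact (hPQ.le_order _ (Or.inl ⟨hP, hPQ.right.compl_mem hXQ
      (Set.disjoint_left.2 fun _ h h' => h'.1 h) (ho.le.trans hlk)⟩)).not_gt ho
  -- Neither part of `Xᶜ` is in `P`, since it would distinguish `P` from `Q` with order below `l`.
  refine hPQ.robust_left ⟨Y, Xᶜ, Set.finite_of_encard_le_coe hYl.le, hYl.le.trans hPQ'.le_robust,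
    ?_, ?_, ?_, hXP, low _ h1', low _ h2'⟩
  · rwa [order_compl, hXl]
  · rwa [order_compl, hXl, corner_comm, ← compl_compl Y]
  · rwa [order_compl, hXl, corner_comm]

theorem RobustPair.exists_splits_not_crosses (hPQ : RobustPair r k l P Q)
    (hPQ' : RobustPair r k' l' P' Q') (hlt : l < l') (hS : Splits l P Q S)
    (hT : Splits l' P' Q' T) : ∃ c, Splits l' P' Q' c ∧ c ⊆ S ∪ T ∧ ¬ Crosses G S c := by
  obtain ⟨X, hX, hXP, hXQ⟩ := hS.exists_side hPQ
  have hXk : order X ≤ k' := by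
    rw [hS.order_eq hX]
    exact_mod_cast hlt.le.trans hPQ'.le
  rcases hPQ'.left.mem_or_compl_mem X hXk with h | h
  · exact hPQ.symm.exists_splits_not_crosses_of_mem hPQ' hlt hS.symm hT hX hXQ hXP h
  · exact hPQ.exists_splits_not_crosses_of_mem hPQ' hlt hS hT hX.compl (by rwa [compl_compl]) hXQ h

/-- The separators of size `l` that split some robust pair efficiently. -/
def efficientSeparators (G : SimpleGraph V) (r : ℕ∞) (l : ℕ) : Set (Set V) :=
  {U | ∃ (k : ℕ) (P Q : Set (Set G.edgeSet)), RobustPair r k l P Q ∧ Splits l P Q U}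

theorem tight_of_mem_efficientSeparators (h : U ∈ efficientSeparators G r l) : Tight G U := by
  obtain ⟨k, P, Q, -, h⟩ := h
  exact h.tight

theorem encard_of_mem_efficientSeparators (h : U ∈ efficientSeparators G r l) : U.encard = l := by
  obtain ⟨k, P, Q, -, h⟩ := h
  exact h.1

theorem finite_of_mem_efficientSeparators (h : U ∈ efficientSeparators G r l) : U.Finite :=
  Set.finite_of_encard_le_coe (encard_of_mem_efficientSeparators h).le

/-- The efficient separators of size `l` that cross `S`. -/
def crossing (G : SimpleGraph V) (r : ℕ∞) (l : ℕ) (S : Set V) : Set (Set V) :=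
  {U ∈ efficientSeparators G r l | Crosses G U S}

theorem finite_crossing (hS : S.Finite) (hSt : Tight G S) : (crossing G r l S).Finite :=
  (finite_tight_crosses hS hSt l).subset fun _ hU =>
    ⟨tight_of_mem_efficientSeparators hU.1, encard_of_mem_efficientSeparators hU.1, hU.2⟩

/-- Counted via unions and intersections: what crosses `c₁` or `c₂` crosses `S` or `T`, and what
crosses both crosses both. Strictness comes from `T`, which crosses `S` but neither corner. -/
theorem ncard_crossing_add_lt {c₁ c₂ E₁ E₂ : Set V} (hS : S ∈ efficientSeparators G r l)
    (hT : T ∈ efficientSeparators G r l) (hST : Crosses G T S) (hX : Side G S X) (hY : Side G T Y)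
    (hc₁ : c₁ ∈ efficientSeparators G r l) (hc₂ : c₂ ∈ efficientSeparators G r l)
    (h₁ : c₁ = boundary (X ∩ Y)) (h₂ : c₂ = boundary (Xᶜ ∩ Yᶜ))
    (hE₁ : Full G c₁ E₁) (hEX₁ : edgesAt G E₁ ⊆ X ∩ Y) (hn₁ : (edgesAt G E₁).Nonempty)
    (hE₂ : Full G c₂ E₂) (hEX₂ : edgesAt G E₂ ⊆ Xᶜ ∩ Yᶜ) (hn₂ : (edgesAt G E₂).Nonempty) :
    (crossing G r l c₁).ncard + (crossing G r l c₂).ncard <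
      (crossing G r l S).ncard + (crossing G r l T).ncard := by
  have hSt := tight_of_mem_efficientSeparators hS
  have hTt := tight_of_mem_efficientSeparators hT
  have hc₁t := tight_of_mem_efficientSeparators hc₁
  have hc₂t := tight_of_mem_efficientSeparators hc₂
  have hfS := finite_crossing (r := r) (l := l) (finite_of_mem_efficientSeparators hS) hSt
  have hfT := finite_crossing (r := r) (l := l) (finite_of_mem_efficientSeparators hT) hTt
  have hf₁ := finite_crossing (r := r) (l := l) (finite_of_mem_efficientSeparators hc₁) hc₁t
  have hf₂ := finite_crossing (r := r) (l := l) (finite_of_mem_efficientSeparators hc₂) hc₂t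
  have hu₁ : c₁ ⊆ S ∪ T := by
    rw [h₁, ← hX.boundary_eq, ← hY.boundary_eq]
    exact boundary_inter_subset_union X Y
  have hu₂ : c₂ ⊆ S ∪ T := by
    rw [h₂, ← hX.compl.boundary_eq, ← hY.compl.boundary_eq]
    exact boundary_inter_subset_union Xᶜ Yᶜ
  have hv₁ : c₁ ⊆ verts Y := by
    rw [h₁]
    exact Set.inter_subset_left.trans (verts_mono Set.inter_subset_right)
  have hv₂ : c₂ ⊆ verts Yᶜ := by
    rw [h₂]
    exact Set.inter_subset_left.trans (verts_mono Set.inter_subset_right)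
  have hunion : ∀ c ⊆ S ∪ T, crossing G r l c ⊆ crossing G r l S ∪ crossing G r l T := by
    rintro c hc U ⟨hU, hUc⟩
    by_contra hn
    rw [Set.mem_union, not_or] at hn
    exact not_crosses_of_subset_union hSt hTt (tight_of_mem_efficientSeparators hU) hST
      (fun h => hn.1 ⟨hU, h⟩) (fun h => hn.2 ⟨hU, h⟩) hc hUc
  have hlt : crossing G r l c₁ ∪ crossing G r l c₂ ⊂ crossing G r l S ∪ crossing G r l T := by
    refine (Set.ssubset_iff_of_subset (Set.union_subset (hunion _ hu₁) (hunion _ hu₂))).2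
      ⟨T, Or.inl ⟨hT, hST⟩, ?_⟩
    rintro (h | h)
    · exact hY.not_crosses hv₁ (h.2.symm hc₁t)
    · exact hY.compl.not_crosses hv₂ (h.2.symm hc₂t)
  have hinter : crossing G r l c₁ ∩ crossing G r l c₂ ⊆ crossing G r l S ∩ crossing G r l T := by
    rintro U ⟨⟨hU, h1⟩, -, h2⟩
    have hUt := tight_of_mem_efficientSeparators hU
    have hn : ¬ (Disjoint E₁ U ∨ Disjoint E₂ U) := by
      rw [not_or, Set.not_disjoint_iff_nonempty_inter, Set.not_disjoint_iff_nonempty_inter]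
      exact ⟨h1.inter_full_nonempty hE₁, h2.inter_full_nonempty hE₂⟩
    refine ⟨⟨hU, Crosses.symm (by_contra fun h => hn ?_) hUt⟩, hU,
      Crosses.symm (by_contra fun h => hn ?_) hUt⟩
    · exact hX.disjoint_or_disjoint h hE₁.1 (hEX₁.trans Set.inter_subset_left) hn₁ hE₂.1
        (hEX₂.trans Set.inter_subset_left) hn₂
    · exact hY.disjoint_or_disjoint h hE₁.1 (hEX₁.trans Set.inter_subset_right) hn₁ hE₂.1
        (hEX₂.trans Set.inter_subset_right) hn₂
  rw [← Set.ncard_union_add_ncard_inter _ _ hf₁ hf₂, ← Set.ncard_union_add_ncard_inter _ _ hfS hfT]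
  exact add_lt_add_of_lt_of_le (Set.ncard_lt_ncard hlt (hfS.union hfT))
    (Set.ncard_le_ncard hinter (hfS.subset Set.inter_subset_left))

/-- One of `P` and `Q` contains both `X` and `Y`, while the other contains `Xᶜ` or `Yᶜ`. -/
def CornerOf (P Q : Set (Set G.edgeSet)) (X Y : Set G.edgeSet) : Prop :=
  (X ∈ P ∧ Y ∈ P ∧ (Xᶜ ∈ Q ∨ Yᶜ ∈ Q)) ∨ (X ∈ Q ∧ Y ∈ Q ∧ (Xᶜ ∈ P ∨ Yᶜ ∈ P))

theorem RobustPair.distinguishes_inter (hPQ : RobustPair r k l P Q) (h : CornerOf P Q X Y)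
    (hk : (corner X Y).encard ≤ k) : Distinguishes (X ∩ Y) P Q := by
  have main : ∀ {P Q}, RobustPair r k l P Q → X ∈ P → Y ∈ P → (Xᶜ ∈ Q ∨ Yᶜ ∈ Q) →
      Distinguishes (X ∩ Y) P Q := by
    intro P Q hPQ hX hY h
    refine Or.inl ⟨hPQ.left.inter_mem _ hX _ hY hk, ?_⟩
    have ho := (order_inter_le X Y).trans hk
    rcases h with h | h
    · exact hPQ.right.compl_mem h
        (Set.disjoint_compl_left_iff_subset.2 Set.inter_subset_left) ho
    · exact hPQ.right.compl_mem h
        (Set.disjoint_compl_left_iff_subset.2 Set.inter_subset_right) ho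
  rcases h with ⟨h1, h2, h3⟩ | ⟨h1, h2, h3⟩
  exacts [main hPQ h1 h2 h3, (main hPQ.symm h1 h2 h3).symm]

theorem RobustPair.le_encard_corner (hPQ : RobustPair r k l P Q) (h : CornerOf P Q X Y) :
    l ≤ (corner X Y).encard := by
  rcases le_or_gt (corner X Y).encard k with hk | hk
  · exact (hPQ.le_order _ (hPQ.distinguishes_inter h hk)).trans (order_inter_le X Y)
  · exact le_trans (by exact_mod_cast hPQ.le) hk.le

theorem RobustPair.exists_splits_add_lt (hPQ : RobustPair r k l P Q)
    (hPQ' : RobustPair r k' l P' Q') (hS : S ∈ efficientSeparators G r l)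
    (hT : T ∈ efficientSeparators G r l) (hST : Crosses G T S) (hX : Side G S X) (hY : Side G T Y)
    (h : CornerOf P Q X Y) (h' : CornerOf P' Q' Xᶜ Yᶜ) :
    ∃ c₁ c₂, Splits l P Q c₁ ∧ Splits l P' Q' c₂ ∧ c₁ ⊆ S ∪ T ∧ c₂ ⊆ S ∪ T ∧
      (crossing G r l c₁).ncard + (crossing G r l c₂).ncard <
        (crossing G r l S).ncard + (crossing G r l T).ncard := by
  have hsum := encard_corner_add_le X Y
  rw [order, order, hX.boundary_eq, hY.boundary_eq, encard_of_mem_efficientSeparators hS,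
    encard_of_mem_efficientSeparators hT] at hsum
  have hl₁ := hPQ.le_encard_corner h
  have hl₂ := hPQ'.le_encard_corner h'
  have hu₁ : (corner X Y).encard ≤ l := by
    by_contra! hn
    exact (ENat.add_lt_add_of_lt_of_le (by simp) hn hl₂).not_ge hsum
  have hu₂ : (corner Xᶜ Yᶜ).encard ≤ l := by
    by_contra! hn
    exact (ENat.add_lt_add_of_le_of_lt (by simp) hl₁ hn).not_ge hsum
  obtain ⟨hs₁, E₁, hE₁, hEX₁, hn₁⟩ := hPQ.splits_boundary
    (hPQ.distinguishes_inter h (hu₁.trans (by exact_mod_cast hPQ.le)))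
    ((order_inter_le X Y).trans hu₁)
  obtain ⟨hs₂, E₂, hE₂, hEX₂, hn₂⟩ := hPQ'.splits_boundary
    (hPQ'.distinguishes_inter h' (hu₂.trans (by exact_mod_cast hPQ'.le)))
    ((order_inter_le Xᶜ Yᶜ).trans hu₂)
  refine ⟨_, _, hs₁, hs₂, ?_, ?_, ncard_crossing_add_lt hS hT hST hX hY ⟨k, P, Q, hPQ, hs₁⟩
    ⟨k', P', Q', hPQ', hs₂⟩ rfl rfl hE₁ hEX₁ hn₁ hE₂ hEX₂ hn₂⟩
  · rw [← hX.boundary_eq, ← hY.boundary_eq]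
    exact boundary_inter_subset_union X Y
  · rw [← hX.compl.boundary_eq, ← hY.compl.boundary_eq]
    exact boundary_inter_subset_union Xᶜ Yᶜ

/-- Of two crossing efficient separators of the same size, one can be replaced by a separator in
their union that splits the same pair and is crossed by fewer efficient separators. -/
theorem RobustPair.exists_splits_crossing_lt (hPQ : RobustPair r k l P Q)
    (hPQ' : RobustPair r k' l P' Q') (hS : Splits l P Q S) (hT : Splits l P' Q' T)
    (hST : Crosses G T S) :
    (∃ c, Splits l P Q c ∧ c ⊆ S ∪ T ∧
      (crossing G r l c).ncard < (crossing G r l S).ncard) ∨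
    ∃ c, Splits l P' Q' c ∧ c ⊆ S ∪ T ∧
      (crossing G r l c).ncard < (crossing G r l T).ncard := by
  obtain ⟨X, hX, hXP, hXQ⟩ := hS.exists_side hPQ
  obtain ⟨Y, hY, hYP, hYQ⟩ := hT.exists_side hPQ'
  have hSe : S ∈ efficientSeparators G r l := ⟨k, P, Q, hPQ, hS⟩
  have hTe : T ∈ efficientSeparators G r l := ⟨k', P', Q', hPQ', hT⟩
  by_contra! hcon
  obtain ⟨hc, hc'⟩ := hcon
  -- Opposite corners usable by different pairs: the sum of crossing numbers drops, so one
  -- replacement beats `S` or `T`.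
  have one : ∀ X Y, Side G S X → Side G T Y → CornerOf P Q X Y → ¬ CornerOf P' Q' Xᶜ Yᶜ := by
    intro X Y hX hY h h'
    obtain ⟨c₁, c₂, h1, h2, h3, h4, h5⟩ :=
      hPQ.exists_splits_add_lt hPQ' hSe hTe hST hX hY h h'
    have := hc c₁ h1 h3
    have := hc' c₂ h2 h4
    omega
  -- Each pair owns a whole diagonal. With `s` and `t` the crossing numbers of `S` and `T`,
  -- minimality gives `2s < s + t` and `2t < s + t`.
  have two : ∀ X Y, Side G S X → Side G T Y → CornerOf P Q X Y → CornerOf P Q Xᶜ Yᶜ →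
      CornerOf P' Q' X Yᶜ → ¬ CornerOf P' Q' Xᶜ Y := by
    intro X Y hX hY h h' g g'
    obtain ⟨c₁, c₂, h1, h2, h3, h4, h5⟩ :=
      hPQ.exists_splits_add_lt hPQ hSe hTe hST hX hY h h'
    obtain ⟨d₁, d₂, g1, g2, g3, g4, g5⟩ :=
      hPQ'.exists_splits_add_lt hPQ' hSe hTe hST hX hY.compl g (by rwa [compl_compl])
    have := hc c₁ h1 h3
    have := hc c₂ h2 h4
    have := hc' d₁ g1 g3
    have := hc' d₂ g2 g4
    omega
  have o1 := one X Y hX hY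
  have o2 := one X Yᶜ hX hY.compl
  have o3 := one Xᶜ Y hX.compl hY
  have o4 := one Xᶜ Yᶜ hX.compl hY.compl
  have t1 := two X Y hX hY
  have t2 := two X Yᶜ hX hY.compl
  have hXl := hS.order_eq hX
  have hYl := hT.order_eq hY
  have hlk : (l : ℕ∞) ≤ k := by exact_mod_cast hPQ.le
  have hlk' : (l : ℕ∞) ≤ k' := by exact_mod_cast hPQ'.le
  have p1 := hPQ.left.mem_or_compl_mem Y (hYl.trans_le hlk)
  have p2 := hPQ.right.mem_or_compl_mem Y (hYl.trans_le hlk)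
  have p3 := hPQ'.left.mem_or_compl_mem X (hXl.trans_le hlk')
  have p4 := hPQ'.right.mem_or_compl_mem X (hXl.trans_le hlk')
  simp only [CornerOf, compl_compl] at o1 o2 o3 o4 t1 t2
  clear hc hc' one two hPQ hPQ' hS hT hST hSe hTe hX hY hXl hYl hlk hlk'
  -- Purely propositional: however `P`, `Q` orient `Y` and `P'`, `Q'` orient `X`, one of these two
  -- configurations occurs.
  grind

end Uncrossing

/-! ### A nested family of separators -/

section Levels

variable {V : Type*} {G : SimpleGraph V} {S T U C D E c : Set V} {X Y Z : Set G.edgeSet}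
  {P Q P' Q' : Set (Set G.edgeSet)} {k k' l l' : ℕ} {r : ℕ∞} {N : Set (Set V)}

/-- For each robust pair, the efficiently splitting separators of size `l` that no element of `N`
crosses and that, subject to this, are crossed by as few efficient separators as possible. -/
def nextLevel (G : SimpleGraph V) (r : ℕ∞) (l : ℕ) (N : Set (Set V)) : Set (Set V) :=
  {S | ∃ (k : ℕ) (P Q : Set (Set G.edgeSet)), RobustPair r k l P Q ∧ Splits l P Q S ∧
    (∀ U ∈ N, ¬ Crosses G U S) ∧ ∀ c, Splits l P Q c → (∀ U ∈ N, ¬ Crosses G U c) →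
      (crossing G r l S).ncard ≤ (crossing G r l c).ncard}

/-- The separators of size less than `l` in the nested family. -/
def levels (G : SimpleGraph V) (r : ℕ∞) : ℕ → Set (Set V)
  | 0 => ∅
  | l + 1 => levels G r l ∪ nextLevel G r l (levels G r l)

theorem exists_mem_efficientSeparators (h : U ∈ levels G r l) :
    ∃ l' < l, U ∈ efficientSeparators G r l' := by
  induction l with
  | zero => exact h.elim
  | succ l ih =>
    rcases h with h | ⟨k, P, Q, hPQ, hS, -⟩
    · obtain ⟨l', hl', h⟩ := ih h
      exact ⟨l', hl'.trans l.lt_succ_self, h⟩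
    · exact ⟨l, l.lt_succ_self, k, P, Q, hPQ, hS⟩

theorem tight_of_mem_levels (h : U ∈ levels G r l) : Tight G U := by
  obtain ⟨l', -, h⟩ := exists_mem_efficientSeparators h
  exact tight_of_mem_efficientSeparators h

theorem not_crosses_of_mem_nextLevel (hN : ∀ U ∈ N, Tight G U) (hS : S ∈ nextLevel G r l N)
    (hT : T ∈ nextLevel G r l N) : ¬ Crosses G T S := by
  intro hST
  obtain ⟨k, P, Q, hPQ, hS, hNS, hmin⟩ := hS
  obtain ⟨k', P', Q', hPQ', hT, hNT, hmin'⟩ := hT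
  have hNc : ∀ c ⊆ S ∪ T, ∀ U ∈ N, ¬ Crosses G U c := fun c hc U hU =>
    not_crosses_of_subset_union hS.tight hT.tight (hN U hU) hST (hNS U hU) (hNT U hU) hc
  rcases hPQ.exists_splits_crossing_lt hPQ' hS hT hST with ⟨c, hc, hcST, hlt⟩ | ⟨c, hc, hcST, hlt⟩
  · exact (hmin c hc (hNc c hcST)).not_gt hlt
  · exact (hmin' c hc (hNc c hcST)).not_gt hlt

theorem not_crosses_of_mem_levels (hS : S ∈ levels G r l) (hT : T ∈ levels G r l) :
    ¬ Crosses G T S := by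
  induction l with
  | zero => exact hS.elim
  | succ l ih =>
    have htight := tight_of_mem_levels hT
    rcases hS with hS | hS <;> rcases hT with hT | hT
    · exact ih hS hT
    · obtain ⟨-, -, -, -, -, h, -⟩ := hT
      exact fun h' => h S hS (h'.symm (tight_of_mem_levels hS))
    · obtain ⟨-, -, -, -, -, h, -⟩ := hS
      exact h T hT
    · exact not_crosses_of_mem_nextLevel (fun _ => tight_of_mem_levels) hS hT

theorem finite_levels_crosses (hS : S.Finite) (hSt : Tight G S) :
    {U ∈ levels G r l | Crosses G U S}.Finite := by
  refine ((Set.finite_lt_nat l).biUnion fun j _ =>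
    finite_crossing (r := r) (l := j) hS hSt).subset ?_
  rintro U ⟨hU, h⟩
  obtain ⟨j, hj, hU⟩ := exists_mem_efficientSeparators hU
  exact Set.mem_biUnion hj ⟨hU, h⟩

/-- Take `c` crossed by the fewest members of the lower levels. Uncrossing `c` from such a `U`
inside `U ∪ c` removes `U` and adds none, since lower levels do not cross `U`. -/
theorem RobustPair.exists_splits_not_crosses_levels (hPQ : RobustPair r k l P Q)
    (h : ∃ c, Splits l P Q c) : ∃ c, Splits l P Q c ∧ ∀ U ∈ levels G r l, ¬ Crosses G U c := by
  obtain ⟨c, hc, hmin⟩ := exists_minimalFor_of_wellFoundedLT (Splits l P Q)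
    (fun c => {U ∈ levels G r l | Crosses G U c}.ncard) h
  refine ⟨c, hc, fun U hU hUc => ?_⟩
  obtain ⟨l', hl', k', P', Q', hPQ', hU'⟩ := exists_mem_efficientSeparators hU
  obtain ⟨c', hc', hsub, hUc'⟩ := hPQ'.exists_splits_not_crosses hPQ hl' hU' hc
  have hlt : {W ∈ levels G r l | Crosses G W c'} ⊂ {W ∈ levels G r l | Crosses G W c} := by
    refine (Set.ssubset_iff_of_subset ?_).2 ⟨U, ⟨hU, hUc⟩, fun h => hUc' h.2⟩
    rintro W ⟨hW, hWc'⟩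
    refine ⟨hW, by_contra fun hWc => ?_⟩
    exact not_crosses_of_subset_union hU'.tight hc.tight (tight_of_mem_levels hW)
      (hUc.symm hc.tight) (not_crosses_of_mem_levels hU hW) hWc hsub hWc'
  have hcard := Set.ncard_lt_ncard hlt
    (finite_levels_crosses (Set.finite_of_encard_le_coe hc.1.le) hc.tight)
  exact hcard.not_ge (hmin hc' hcard.le)

theorem RobustPair.exists_splits_mem_levels (hPQ : RobustPair r k l P Q)
    (h : ∃ c, Splits l P Q c) : ∃ S ∈ levels G r (l + 1), Splits l P Q S := by
  obtain ⟨S, ⟨hS, hN⟩, hmin⟩ := exists_minimalFor_of_wellFoundedLT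
    (fun c => Splits l P Q c ∧ ∀ U ∈ levels G r l, ¬ Crosses G U c)
    (fun c => (crossing G r l c).ncard) (hPQ.exists_splits_not_crosses_levels h)
  refine ⟨S, Or.inr ⟨k, P, Q, hPQ, hS, hN, fun c hc hNc => ?_⟩, hS⟩
  exact (le_total _ _).elim id fun hle => hmin ⟨hc, hNc⟩ hle

/-- The nested family of efficient separators. -/
def separatorFamily (G : SimpleGraph V) (r : ℕ∞) : Set (Set V) :=
  ⋃ l, levels G r l

theorem finite_of_mem_separatorFamily (h : S ∈ separatorFamily G r) : S.Finite := by
  obtain ⟨l, h⟩ := Set.mem_iUnion.1 h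
  obtain ⟨l', -, h⟩ := exists_mem_efficientSeparators h
  exact finite_of_mem_efficientSeparators h

theorem not_crosses_of_mem_separatorFamily (hS : S ∈ separatorFamily G r)
    (hT : T ∈ separatorFamily G r) : ¬ Crosses G T S := by
  obtain ⟨l, hS⟩ := Set.mem_iUnion.1 hS
  obtain ⟨l', hT⟩ := Set.mem_iUnion.1 hT
  have hmono : Monotone (levels G r) := monotone_nat_of_le_succ fun n => Set.subset_union_left
  exact not_crosses_of_mem_levels (hmono (le_max_left l l') hS) (hmono (le_max_right l l') hT)

end Levels

/-! ### From nested separators to nested separations -/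

section Facing

variable {V : Type*} {G : SimpleGraph V} {S T S' T' U C D K M D' : Set V} {𝒮 : Set (Set V)}

/-- `C` is a full component of `G - S` that contains a vertex of `T`. -/
def Toward (G : SimpleGraph V) (S T C : Set V) : Prop :=
  Full G S C ∧ (C ∩ T).Nonempty

/-- Each of `S` and `T` has a full component that meets the other. -/
def Facing (G : SimpleGraph V) (S T : Set V) : Prop :=
  (∃ C, Toward G S T C) ∧ ∃ D, Toward G T S D

theorem Toward.eq (hC : Toward G S T C) (hD : Toward G S T D) (h : ¬ Crosses G S T) : C = D :=
  by_contra fun hne => h ⟨C, D, hC.1.1, hD.1.1, hne, hC.2, hD.2⟩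

/-- From `T`, the sets `S` and `T'` lie behind different components `K` and `D`; so `K ⊆ D'` and `D
⊆ M`, and `S` and `T'` see each other across `T`. -/
theorem Toward.trans (hD : Toward G T T' D) (hD' : Toward G T' T D') (hK : Toward G T S K)
    (hM : Toward G S T M) (hne : K ≠ D) (h : ¬ Crosses G T T') (h' : ¬ Crosses G T S) :
    Toward G T' S D' ∧ Toward G S T' M := by
  have hKT : Disjoint K T' := by
    rw [Set.disjoint_iff_inter_eq_empty, ← Set.not_nonempty_iff_eq_empty]
    exact fun hn => hne (Toward.eq ⟨hK.1, hn⟩ hD h)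
  have hDS : Disjoint D S := by
    rw [Set.disjoint_iff_inter_eq_empty, ← Set.not_nonempty_iff_eq_empty]
    exact fun hn => hne (Toward.eq hK ⟨hD.1, hn⟩ h')
  exact ⟨⟨hD'.1, hK.2.mono (Set.inter_subset_inter_left _ (hK.1.absorb hKT hD'.1.1 hD'.2).1)⟩,
    hM.1, hD.2.mono (Set.inter_subset_inter_left _ (hD.1.absorb hDS hM.1.1 hM.2).1)⟩

theorem nested_edgesAt_of_disjoint (hC : IsComp G S C) (hD : IsComp G T D) (h : Disjoint C T) :
    edgesAt G C ⊆ edgesAt G D ∨ edgesAt G C ⊆ (edgesAt G D)ᶜ := by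
  by_cases hCD : ∃ v ∈ C, v ∈ D
  · obtain ⟨v, hvC, hvD⟩ := hCD
    exact Or.inl (edgesAt_mono (hC.subset_of_disjoint hD h hvC hvD))
  · refine Or.inr ?_
    rintro e ⟨v, hv, hve⟩ ⟨w, hw, hwe⟩
    exact hCD ⟨v, hv, hD.mem_of_mem_edge hw hwe hve (Set.disjoint_left.1 h hv)⟩

theorem nested_edgesAt (hC : Full G S C) (hD : Full G T D)
    (h : ¬ (Toward G S T C ∧ Toward G T S D)) : Nested (edgesAt G C) (edgesAt G D) := by
  by_cases hCT : Disjoint C T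
  · rcases nested_edgesAt_of_disjoint hC.1 hD.1 hCT with h | h
    · exact Or.inl h
    · exact Or.inr (Or.inr (Or.inr (Set.subset_compl_comm.1 h)))
  by_cases hDS : Disjoint D S
  · exact Or.inr (Or.inr (nested_edgesAt_of_disjoint hD.1 hC.1 hDS))
  rw [Set.not_disjoint_iff_nonempty_inter] at hCT hDS
  exact absurd ⟨⟨hC, hCT⟩, hD, hDS⟩ h

/-- `T` is the first element of `𝒮` facing `S`, in a fixed well-ordering. -/
def FirstFacing (G : SimpleGraph V) (𝒮 : Set (Set V)) (S T : Set V) : Prop :=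
  T ∈ 𝒮 ∧ Facing G S T ∧ ∀ T' ∈ 𝒮, Facing G S T' → ¬ WellOrderingRel T' T

theorem FirstFacing.eq (h : FirstFacing G 𝒮 S T) (h' : FirstFacing G 𝒮 S T') : T = T' := by
  rcases trichotomous_of WellOrderingRel T T' with hlt | heq | hlt
  · exact absurd hlt (h'.2.2 T h.1 h.2.1)
  · exact heq
  · exact absurd hlt (h.2.2 T' h'.1 h'.2.1)

theorem Facing.exists_firstFacing (h : Facing G S T) (hT : T ∈ 𝒮) :
    ∃ U, FirstFacing G 𝒮 S U := by
  obtain ⟨U, hU, hmin⟩ := (WellOrderingRel.isWellOrder (α := Set V)).wf.has_min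
    {U | U ∈ 𝒮 ∧ Facing G S U} ⟨T, hT, h⟩
  exact ⟨U, hU.1, hU.2, fun T' h1 h2 => hmin T' ⟨h1, h2⟩⟩

/-- `C` is a full component of `G - S` that does not meet the first element of `𝒮` facing `S`. -/
def Chosen (G : SimpleGraph V) (𝒮 : Set (Set V)) (S C : Set V) : Prop :=
  Full G S C ∧ ∀ T, FirstFacing G 𝒮 S T → ¬ Toward G S T C

theorem Chosen.not_toward (h𝒮 : ∀ S ∈ 𝒮, ∀ T ∈ 𝒮, ¬ Crosses G T S) (hS : S ∈ 𝒮) (hT : T ∈ 𝒮)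
    (hC : Chosen G 𝒮 S C) (hD : Chosen G 𝒮 T D) : ¬ (Toward G S T C ∧ Toward G T S D) := by
  rintro ⟨hCT, hDS⟩
  obtain ⟨S₀, hS₀⟩ := Facing.exists_firstFacing ⟨⟨C, hCT⟩, D, hDS⟩ hT
  obtain ⟨T₀, hT₀⟩ := Facing.exists_firstFacing ⟨⟨D, hDS⟩, C, hCT⟩ hS
  obtain ⟨⟨K, hK⟩, M, hM⟩ := hS₀.2.1
  obtain ⟨⟨K', hK'⟩, M', hM'⟩ := hT₀.2.1
  have hKC : K ≠ C := fun h => hC.2 S₀ hS₀ (h ▸ hK)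
  have hKD : K' ≠ D := fun h => hD.2 T₀ hT₀ (h ▸ hK')
  obtain ⟨h1, h2⟩ := hCT.trans hDS hK hM hKC (h𝒮 T hT S hS) (h𝒮 S₀ hS₀.1 S hS)
  obtain ⟨h3, h4⟩ := hDS.trans hCT hK' hM' hKD (h𝒮 S hS T hT) (h𝒮 T₀ hT₀.1 T hT)
  -- By `Toward.trans`, `S₀` also faces `T` and `T₀` also faces `S`, so each comes no later than the
  -- other. Then `D` points toward `T₀`, the direction discarded at `T`.
  have heq : S₀ = T₀ := by
    rcases trichotomous_of WellOrderingRel S₀ T₀ with hlt | heq | hlt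
    · exact absurd hlt (hT₀.2.2 S₀ hS₀.1 ⟨⟨D, h1⟩, M, h2⟩)
    · exact heq
    · exact absurd hlt (hS₀.2.2 T₀ hT₀.1 ⟨⟨C, h3⟩, M', h4⟩)
  exact hD.2 T₀ hT₀ (heq ▸ h1)

theorem chosen_or_chosen (h𝒮 : ∀ S ∈ 𝒮, ∀ T ∈ 𝒮, ¬ Crosses G T S) (hS : S ∈ 𝒮)
    (hC : Full G S C) (hD : Full G S D) (hne : C ≠ D) : Chosen G 𝒮 S C ∨ Chosen G 𝒮 S D := by
  by_contra! hn
  simp only [Chosen, hC, hD, true_and, not_forall, not_not] at hn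
  obtain ⟨⟨T, hT, hCT⟩, T', hT', hDT⟩ := hn
  obtain rfl := hT.eq hT'
  exact hne (hCT.eq hDT (h𝒮 T hT.1 S hS))

end Facing

/-! ### Assembling the theorem -/

theorem exists_robustPair {V : Type*} {G : SimpleGraph V} {r : ℕ∞} {k : ℕ}
    {P Q : Set (Set G.edgeSet)} (hP : IsProfile k P) (hQ : IsProfile k Q) (hPr : IsRobust r k P)
    (hQr : IsRobust r k Q) (h : ∃ Z, Distinguishes Z P Q ∧ order Z ≤ r) :
    ∃ l X, RobustPair r k l P Q ∧ Distinguishes X P Q ∧ order X = l := by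
  obtain ⟨Z, hZ, hZr⟩ := h
  obtain ⟨X, hX, hmin⟩ := exists_minimalFor_of_wellFoundedLT
    (fun X : Set G.edgeSet => Distinguishes X P Q) order ⟨Z, hZ⟩
  have hmin' : ∀ Z, Distinguishes Z P Q → order X ≤ order Z := fun Z hZ =>
    (le_total _ _).elim id fun hle => hmin hZ hle
  have hXk : order X ≤ k := by
    rcases hX with h | h
    exacts [hP.order_le X h.1, hQ.order_le X h.1]
  obtain ⟨l, hl⟩ := ENat.ne_top_iff_exists.1 (hXk.trans_lt (ENat.natCast_lt_top k)).ne
  refine ⟨l, X, ⟨hP, hQ, hPr, hQr, ?_, ?_, ?_⟩, hX, hl.symm⟩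
  · rw [← hl] at hXk
    exact_mod_cast hXk
  · rw [hl]
    exact (hmin' Z hZ).trans hZr
  · rwa [hl]

end EdgeSeparation

theorem mainTheorem3 {V : Type*} (G : SimpleGraph V) (r : ℕ∞) :
    ∃ N : Set (Set G.edgeSet),
      (∀ X ∈ N, (EdgeSeparation.boundary X).Finite) ∧
      (∀ X ∈ N, ∀ Y ∈ N, EdgeSeparation.Nested X Y) ∧
      ∀ (k : ℕ) (P Q : Set (Set G.edgeSet)),
        EdgeSeparation.IsProfile k P → EdgeSeparation.IsProfile k Q →
        EdgeSeparation.IsRobust r k P → EdgeSeparation.IsRobust r k Q →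
        (∃ Z : Set G.edgeSet, EdgeSeparation.Distinguishes Z P Q ∧ EdgeSeparation.order Z ≤ r) →
        ∃ X ∈ N, EdgeSeparation.DistinguishesEfficiently X P Q := by
  have h𝒮 : ∀ S ∈ EdgeSeparation.separatorFamily G r,
      ∀ T ∈ EdgeSeparation.separatorFamily G r, ¬ EdgeSeparation.Crosses G T S :=
    fun S hS T hT => EdgeSeparation.not_crosses_of_mem_separatorFamily hS hT
  refine ⟨{X | ∃ S ∈ EdgeSeparation.separatorFamily G r, ∃ C,
    EdgeSeparation.Chosen G (EdgeSeparation.separatorFamily G r) S C ∧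
    EdgeSeparation.edgesAt G C = X}, ?_, ?_, ?_⟩
  · rintro X ⟨S, hS, C, hC, rfl⟩
    exact (EdgeSeparation.finite_of_mem_separatorFamily hS).subset hC.1.1.boundary_edgesAt_subset
  · rintro X ⟨S, hS, C, hC, rfl⟩ Y ⟨T, hT, D, hD, rfl⟩
    exact EdgeSeparation.nested_edgesAt hC.1 hD.1 (hC.not_toward h𝒮 hS hT hD)
  · intro k P Q hP hQ hPr hQr hZ
    obtain ⟨l, X, hPQ, hX, hXl⟩ := EdgeSeparation.exists_robustPair hP hQ hPr hQr hZ
    obtain ⟨S, hS, hspl⟩ := hPQ.exists_splits_mem_levels (hPQ.exists_splits hX hXl.le)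
    have hS𝒮 : S ∈ EdgeSeparation.separatorFamily G r := Set.mem_iUnion.2 ⟨l + 1, hS⟩
    obtain ⟨hSl, C, D, hC, hD, hne, hCP, hDQ⟩ := hspl
    have hlk : (l : ℕ∞) ≤ k := by exact_mod_cast hPQ.le
    have hCl := hC.1.order_edgesAt_le.trans hSl.le
    have hDl := hD.1.order_edgesAt_le.trans hSl.le
    have hdisj := hC.1.disjoint_edgesAt hD.1 hne
    -- Either component gives an efficient distinguisher, so it does not matter which of the two
    -- survives.
    rcases EdgeSeparation.chosen_or_chosen h𝒮 hS𝒮 hC hD hne with h | h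
    · exact ⟨_, ⟨S, hS𝒮, C, h, rfl⟩,
        Or.inl ⟨hCP, hQ.compl_mem hDQ hdisj.symm (hCl.trans hlk)⟩,
        fun Z hZ => hCl.trans (hPQ.le_order Z hZ)⟩
    · exact ⟨_, ⟨S, hS𝒮, D, h, rfl⟩,
        Or.inr ⟨hDQ, hP.compl_mem hCP hdisj (hDl.trans hlk)⟩,
        fun Z hZ => hDl.trans (hPQ.le_order Z hZ)⟩
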